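/- Let $k\ge 1$, let $M_k(\mathbb C)$ be the algebra of complex $k\times k$ matrices, $M_k^+(\mathbb C)$ its cone of positive semidefinite matrices, $\|a\|_1=\mathrm{tr}\,(a^*a)^{1/2}$ the trace norm, and $\mathcal G(\mathbb C^k)=\{\rho\in M_k^+(\mathbb C):\|\rho\|_1=1\}$ the set of density matrices. A channel is a completely positive, trace-preserving linear map $f:M_k(\mathbb C)\to M_k(\mathbb C)$; its dual $f^*$ is defined by $\mathrm{tr}(a\,f^*(b))=\mathrm{tr}(f(a)\,b)$ for all $a,b$. A linear map $f$ on $M_k(\mathbb C)$ is strictly positive if $f(a)$ is positive definite for every $a\in M_k^+(\mathbb C)\setminus\{0\}$. Let $(X,\mathscr A,\mathrm P)$ be a probability space and $T:X\to X$ a measure-preserving bijection with measurable inverse which is ergodic, i.e. $\mathrm P(A)\in\{0,1\}$ whenever $A\in\mathscr A$ and $T^{-1}(A)=A$. Let $f_0$ be an $\mathscr A$-measurable map on $X$ whose values are channels on $M_k(\mathbb C)$, and set $f_n(x)=f_0(T^n x)$ for $x\in X$, $n\in\mathbb Z$. Assume that there is a positive integer $N$ such that 1. $\mathrm P(f_N\circ\cdots\circ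 f_0\text{ is strictly positive})>0$, and 2. $\mathrm P(\ker(f_0^*)\cap M_k^+(\mathbb C)=\{0\})=1$. Then there are a (deterministic) number $\alpha>0$, an $\mathscr A$-measurable map $g_0:X\to\mathcal G(\mathbb C^k)$ and, for each $z\in\mathbb Z$, an $\mathscr A$-measurable function $C_{\alpha,z}:X\to[0,\infty]$ which is finite $\mathrm P$-almost surely, such that, with $g_n(x)=g_0(T^n x)$ for $n\in\mathbb Z$, for all $(m,z,n)\in\mathbb Z^3$ with $m<n$ and $m\le z\le n$ and at every $x \in X$, $$\|f_n\circ\cdots\circ f_m(\rho)-g_n\|_1\le C_{\alpha,z}\,e^{-\alpha(n-m)}\qquad\text{for all }\rho\in\mathcal G(\mathbb C^k).$$ -/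

import Mathlib

/-! Channels on the matrix algebra `M_k(ℂ)`, density matrices, and compositions of a two-sided
sequence of channels. -/

/-- `M_k(ℂ)`. -/
abbrev Mat (k : ℕ) : Type := Matrix (Fin k) (Fin k) ℂ

open scoped ComplexOrder

section Norms

open scoped MatrixOrder Matrix.Norms.L2Operator CStarAlgebra

/-- The trace norm `‖a‖₁ = tr |a|`, where `|a| = (a* a)^{1/2}`. -/
noncomputable def traceNorm {k : ℕ} (a : Mat k) : ℝ := (CFC.abs a).trace.re

/-- `f` is a channel on `M_k(ℂ)` (in the Schrödinger picture): completely positive and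
trace preserving. -/
def IsChannel {k : ℕ} (f : Mat k →ₗ[ℂ] Mat k) : Prop :=
  (∃ Φ : Mat k →CP Mat k, Φ.toLinearMap = f) ∧ ∀ a : Mat k, (f a).trace = a.trace

/-- Density matrices: `a ≥ 0` and `‖a‖₁ = 1`. -/
def IsDensity {k : ℕ} (a : Mat k) : Prop := a.PosSemidef ∧ traceNorm a = 1

theorem isDensity_iff {k : ℕ} (a : Mat k) : IsDensity a ↔ a.PosSemidef ∧ a.trace = 1 := by
  unfold IsDensity traceNorm
  refine and_congr_right fun h => ?_
  have hn : 0 ≤ a := Matrix.nonneg_iff_posSemidef.mpr h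
  rw [CFC.abs_of_nonneg a hn]
  have him : a.trace.im = 0 := (Complex.nonneg_iff.mp h.trace_nonneg).2.symm
  constructor
  · intro h1
    exact Complex.ext (by simpa using h1) (by simpa using him)
  · intro h1
    simp [h1]

end Norms

/-- The dual `f*` of a linear map `f` on `M_k(ℂ)` with respect to the trace pairing: the linear map
with `tr (a f*(b)) = tr (f(a) b)` for all `a` and `b`, see `trace_mul_dualMap`. -/
noncomputable def dualMap {k : ℕ} (f : Mat k →ₗ[ℂ] Mat k) : Mat k →ₗ[ℂ] Mat k where
  toFun b := Matrix.of fun j i => (f (Matrix.single i j 1) * b).trace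
  map_add' b c := by
    ext i j
    simp [Matrix.mul_add]
  map_smul' r b := by
    ext i j
    simp

theorem trace_mul_dualMap {k : ℕ} (f : Mat k →ₗ[ℂ] Mat k) (a b : Mat k) :
    (a * dualMap f b).trace = (f a * b).trace := by
  conv_rhs => rw [Matrix.matrix_eq_sum_single a]
  have h : ∀ i j, f (Matrix.single i j (a i j)) = a i j • f (Matrix.single i j 1) := by
    intro i j
    rw [← map_smul, Matrix.smul_single, smul_eq_mul, mul_one]
  simp only [map_sum, h, Finset.sum_mul, Matrix.trace_sum, Matrix.smul_mul, Matrix.trace_smul,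
    smul_eq_mul]
  simp [Matrix.trace, Matrix.mul_apply, dualMap]

/-- A map `f` on `M_k(ℂ)` is strictly positive if `f(a) > 0` (positive definite) for every nonzero
positive semidefinite `a`. -/
def IsStrictPos {k : ℕ} (f : Mat k →ₗ[ℂ] Mat k) : Prop :=
  ∀ a : Mat k, a.PosSemidef → a ≠ 0 → (f a).PosDef

/-- `compUp F m j = F (m + j) ∘ ⋯ ∘ F (m + 1) ∘ F m`. -/
def compUp {k : ℕ} (F : ℤ → (Mat k →ₗ[ℂ] Mat k)) (m : ℤ) : ℕ → (Mat k →ₗ[ℂ] Mat k)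
  | 0 => F m
  | j + 1 => F (m + (j + 1 : ℕ)) ∘ₗ compUp F m j

/-- `compRange F n m = F n ∘ ⋯ ∘ F m`, for `m ≤ n`. -/
def compRange {k : ℕ} (F : ℤ → (Mat k →ₗ[ℂ] Mat k)) (n m : ℤ) : Mat k →ₗ[ℂ] Mat k :=
  compUp F m (n - m).toNat

/-- The two-sided sequence `h_n(x) = h₀(Tⁿ x)`, `n ∈ ℤ`, generated by `h₀` along `T`. -/
def orbitSeq {X Y : Type*} [MeasurableSpace X] (T : X ≃ᵐ X) (h₀ : X → Y) (n : ℤ) (x : X) : Y :=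
  h₀ ((T.toEquiv ^ n : Equiv.Perm X) x)

/-- Measurability of a matrix valued map (for the Borel `σ`-algebra of `M_k(ℂ)`), entrywise. -/
def MatMeasurable {X : Type*} [MeasurableSpace X] {k : ℕ} (g : X → Mat k) : Prop :=
  ∀ i j, Measurable fun x => g x i j

/-- Measurability of a map into the linear maps on `M_k(ℂ)` (for the Borel `σ`-algebra of this
finite dimensional space): all evaluations are measurable. -/
def MapMeasurable {X : Type*} [MeasurableSpace X] {k : ℕ} (f : X → (Mat k →ₗ[ℂ] Mat k)) : Prop :=
  ∀ a : Mat k, MatMeasurable fun x => f x a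

/-! ### Trace norm and density matrices. -/

section TraceNorm

open scoped MatrixOrder Matrix.Norms.L2Operator CStarAlgebra
open Matrix

/-! By compactness a strictly positive map satisfies a Doeblin bound `f(a) ≥ ε tr(a) 1`, so a
strictly positive channel contracts the trace distance of states by `1 - kε`. Hence for some `ε` the
set `A` of points where `f_N ∘ ⋯ ∘ f_0` has this bound has positive probability, and each visit of
the orbit to `A` starts a contracting block of `N + 1` maps. Selecting disjoint blocks greedily, a
composition contracts exponentially in the number of visits to `A` (`compUp_contracts_exp_sum`).

Visits have positive linear density: with `c = P(A)/2`, the function `φ = c - 1_A` has negative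
mean, so by a maximal-ergodic argument its Birkhoff sums are a.s. bounded above
(`Ergodic.ae_bddAbove_birkhoffSum`), for `T` and for `T⁻¹`. Splitting `[m, n]` at `z` bounds the
number of visits below by `c(n - m + 1)` minus an error depending only on `T^z x`; this gives
`C_{α,z}`, with `α = βc` and `β = kε/(N + 1)`.

The state `g_n` is the limit of `f_n ∘ ⋯ ∘ f_{n-j}` on a fixed state, which exists by contraction.
Since `f_n ∘ ⋯ ∘ f_m` maps `g_{m-1}` to `g_n`, the estimate is contraction applied to the pair `ρ`,
`g_{m-1}`. -/

theorem exists_posSemidef_sub_eq {k : ℕ} {h : Mat k} (hh : h.IsHermitian) :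
    ∃ p q : Mat k, p.PosSemidef ∧ q.PosSemidef ∧ h = p - q ∧
      traceNorm h = p.trace.re + q.trace.re := by
  have hs : IsSelfAdjoint h := hh
  refine ⟨h⁺, h⁻, Matrix.nonneg_iff_posSemidef.mp (CFC.posPart_nonneg h),
    Matrix.nonneg_iff_posSemidef.mp (CFC.negPart_nonneg h),
    (CFC.posPart_sub_negPart h hs).symm, ?_⟩
  rw [traceNorm, ← CFC.posPart_add_negPart h hs, Matrix.trace_add, Complex.add_re]

theorem traceNorm_eq_sum_abs_eigenvalues {k : ℕ} {h : Mat k} (hh : h.IsHermitian) :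
    traceNorm h = ∑ i, |hh.eigenvalues i| := by
  have hs : IsSelfAdjoint h := hh
  rw [traceNorm, CFC.abs_eq_cfc_norm h hs, hh.cfc_eq, Matrix.IsHermitian.cfc,
    Unitary.conjStarAlgAut_apply, Matrix.trace_mul_cycle, Unitary.coe_star_mul_self, one_mul,
    Matrix.trace_diagonal]
  simp

theorem star_eigenvectorUnitary_mul_mul {k : ℕ} {h : Mat k} (hh : h.IsHermitian) :
    (star hh.eigenvectorUnitary : Mat k) * h * (hh.eigenvectorUnitary : Mat k) =
      diagonal (RCLike.ofReal ∘ hh.eigenvalues) := by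
  have := hh.conjStarAlgAut_star_eigenvectorUnitary
  rwa [Unitary.conjStarAlgAut_star_apply] at this

/-- In an eigenbasis of `p - q` each eigenvalue is a difference of nonnegative diagonal entries of
`p` and `q`, and the change of basis preserves both traces. -/
theorem traceNorm_sub_le {k : ℕ} {p q : Mat k} (hp : p.PosSemidef) (hq : q.PosSemidef) :
    traceNorm (p - q) ≤ p.trace.re + q.trace.re := by
  have hh : (p - q).IsHermitian := hp.isHermitian.sub hq.isHermitian
  set V : Mat k := (hh.eigenvectorUnitary : Mat k) with hV
  have hVV : V * Vᴴ = 1 := Unitary.coe_mul_star_self hh.eigenvectorUnitary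
  have htr : ∀ a : Mat k, (Vᴴ * a * V).trace = a.trace := fun a => by
    rw [Matrix.trace_mul_cycle, hVV, one_mul]
  have hP := hp.conjTranspose_mul_mul_same V
  have hQ := hq.conjTranspose_mul_mul_same V
  have hd : Vᴴ * (p - q) * V = diagonal (RCLike.ofReal ∘ hh.eigenvalues) :=
    star_eigenvectorUnitary_mul_mul hh
  rw [traceNorm_eq_sum_abs_eigenvalues hh, ← htr p, ← htr q, Matrix.trace, Matrix.trace,
    Complex.re_sum, Complex.re_sum, ← Finset.sum_add_distrib]
  refine Finset.sum_le_sum fun i _ => ?_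
  have h1 : hh.eigenvalues i = ((Vᴴ * p * V) i i).re - ((Vᴴ * q * V) i i).re := by
    have := congrArg Complex.re (congrFun (congrFun hd i) i)
    rw [mul_sub, sub_mul] at this
    simpa using this.symm
  have h2 : 0 ≤ ((Vᴴ * p * V) i i).re := (Complex.nonneg_iff.mp hP.diag_nonneg).1
  have h3 : 0 ≤ ((Vᴴ * q * V) i i).re := (Complex.nonneg_iff.mp hQ.diag_nonneg).1
  rw [h1, Matrix.diag_apply, Matrix.diag_apply, abs_le]
  constructor <;> linarith

/-- Turns trace-norm estimates into entrywise convergence. -/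
theorem norm_apply_le_traceNorm {k : ℕ} {h : Mat k} (hh : h.IsHermitian) (i j : Fin k) :
    ‖h i j‖ ≤ traceNorm h := by
  rw [traceNorm_eq_sum_abs_eigenvalues hh]
  have : h i j = ∑ l, (hh.eigenvectorUnitary : Mat k) i l * (hh.eigenvalues l : ℂ) *
      star ((hh.eigenvectorUnitary : Mat k) j l) := by
    conv_lhs => rw [hh.spectral_theorem, Unitary.conjStarAlgAut_apply, Matrix.mul_apply]
    simp [Matrix.star_apply]
  rw [this]
  refine (norm_sum_le _ _).trans (Finset.sum_le_sum fun l _ => ?_)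
  have hU := hh.eigenvectorUnitary.2
  have h1 := entry_norm_bound_of_unitary hU i l
  have h2 := entry_norm_bound_of_unitary hU j l
  rw [norm_mul, norm_mul, norm_star, Complex.norm_real, Real.norm_eq_abs]
  calc _ ≤ 1 * |hh.eigenvalues l| * 1 := by gcongr
    _ = _ := by ring

theorem traceNorm_nonneg {k : ℕ} (a : Mat k) : 0 ≤ traceNorm a :=
  (Complex.nonneg_iff.mp (Matrix.nonneg_iff_posSemidef.mp (CFC.abs_nonneg a)).trace_nonneg).1

theorem IsDensity.posSemidef {k : ℕ} {a : Mat k} (h : IsDensity a) : a.PosSemidef := h.1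

theorem IsDensity.trace_eq_one {k : ℕ} {a : Mat k} (h : IsDensity a) : a.trace = 1 :=
  ((isDensity_iff a).mp h).2

theorem IsDensity.traceNorm_sub_le {k : ℕ} {ρ σ : Mat k} (hρ : IsDensity ρ) (hσ : IsDensity σ) :
    traceNorm (ρ - σ) ≤ 2 := by
  refine (_root_.traceNorm_sub_le hρ.1 hσ.1).trans ?_
  rw [hρ.trace_eq_one, hσ.trace_eq_one]
  norm_num

theorem IsDensity.norm_apply_le {k : ℕ} {ρ : Mat k} (hρ : IsDensity ρ) (i j : Fin k) :
    ‖ρ i j‖ ≤ 1 :=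
  (norm_apply_le_traceNorm hρ.1.isHermitian i j).trans hρ.2.le

theorem isDensity_maximallyMixed {k : ℕ} (hk : 0 < k) : IsDensity ((k : ℂ)⁻¹ • (1 : Mat k)) := by
  rw [isDensity_iff]
  refine ⟨Matrix.PosSemidef.one.smul (by positivity), ?_⟩
  have : (k : ℂ) ≠ 0 := by exact_mod_cast hk.ne'
  simp [this]

theorem isClosed_posSemidef (k : ℕ) : IsClosed {a : Mat k | a.PosSemidef} := by
  have : {a : Mat k | a.PosSemidef} = {a : Mat k | a.IsHermitian} ∩
      ⋂ v : Fin k → ℂ, {a : Mat k | 0 ≤ star v ⬝ᵥ (a *ᵥ v)} := by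
    ext a
    simp [Matrix.posSemidef_iff_dotProduct_mulVec]
  rw [this]
  refine IsClosed.inter (isClosed_eq (by fun_prop) continuous_id)
    (isClosed_iInter fun v => isClosed_le continuous_const ?_)
  exact Continuous.dotProduct continuous_const (Continuous.matrix_mulVec continuous_id continuous_const)

theorem isClosed_isDensity (k : ℕ) : IsClosed {a : Mat k | IsDensity a} := by
  have : {a : Mat k | IsDensity a} = {a | a.PosSemidef} ∩ {a | a.trace = 1} := by
    ext a
    simp [isDensity_iff]
  rw [this]
  exact (isClosed_posSemidef k).inter (isClosed_eq (by fun_prop) continuous_const)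

theorem IsChannel.map_posSemidef {k : ℕ} {f : Mat k →ₗ[ℂ] Mat k} (hf : IsChannel f) {a : Mat k}
    (ha : a.PosSemidef) : (f a).PosSemidef := by
  obtain ⟨⟨Φ, rfl⟩, -⟩ := hf
  exact Matrix.nonneg_iff_posSemidef.mp (map_nonneg Φ (Matrix.nonneg_iff_posSemidef.mpr ha))

theorem IsChannel.map_isDensity {k : ℕ} {f : Mat k →ₗ[ℂ] Mat k} (hf : IsChannel f) {a : Mat k}
    (ha : IsDensity a) : IsDensity (f a) := by
  rw [isDensity_iff, hf.2]
  exact ⟨hf.map_posSemidef ha.1, ha.trace_eq_one⟩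

end TraceNorm

/-! ### Doeblin minorization and contraction. -/

section Doeblin

open Matrix

/-- `f` shrinks the trace distance of density matrices by the factor `κ`. -/
def Contracts {k : ℕ} (f : Mat k →ₗ[ℂ] Mat k) (κ : ℝ) : Prop :=
  ∀ ρ σ : Mat k, IsDensity ρ → IsDensity σ → traceNorm (f ρ - f σ) ≤ κ * traceNorm (ρ - σ)

/-- Doeblin's minorization `f(a) ≥ ε tr(a) 1` for `a ≥ 0`. -/
def Minorizes {k : ℕ} (f : Mat k →ₗ[ℂ] Mat k) (ε : ℝ) : Prop :=
  ∀ a : Mat k, a.PosSemidef → (f a - ((ε : ℂ) * a.trace) • (1 : Mat k)).PosSemidef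

/-- The positive and negative parts of `ρ - σ` have equal trace, so the multiples of `1` split off
from their images cancel; the positive remainders have trace scaled by `1 - kε`. -/
theorem Minorizes.contracts {k : ℕ} {f : Mat k →ₗ[ℂ] Mat k} {ε : ℝ} (hf : Minorizes f ε)
    (htr : ∀ a, (f a).trace = a.trace) : Contracts f (1 - k * ε) := by
  intro ρ σ hρ hσ
  obtain ⟨p, q, hp, hq, hpq, hn⟩ :=
    exists_posSemidef_sub_eq (hρ.posSemidef.isHermitian.sub hσ.posSemidef.isHermitian)
  have ht : p.trace = q.trace := by
    have := congrArg Matrix.trace hpq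
    rw [Matrix.trace_sub, Matrix.trace_sub, hρ.trace_eq_one, hσ.trace_eq_one, sub_self] at this
    exact (sub_eq_zero.mp this.symm)
  have hre : ∀ a : Mat k, (f a - ((ε : ℂ) * a.trace) • (1 : Mat k)).trace.re =
      (1 - k * ε) * a.trace.re := by
    intro a
    rw [Matrix.trace_sub, htr, Matrix.trace_smul, Matrix.trace_one, Fintype.card_fin]
    simp
    ring
  have hsplit : f ρ - f σ = (f p - ((ε : ℂ) * p.trace) • (1 : Mat k)) -
      (f q - ((ε : ℂ) * q.trace) • (1 : Mat k)) := by
    rw [← map_sub, hpq, map_sub, ht]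
    abel
  rw [hsplit, hn]
  refine (traceNorm_sub_le (hf p hp) (hf q hq)).trans ?_
  rw [hre, hre, mul_add]

theorem IsChannel.contracts_one {k : ℕ} {f : Mat k →ₗ[ℂ] Mat k} (hf : IsChannel f) :
    Contracts f 1 := by
  have : Minorizes f 0 := fun a ha => by simpa using hf.map_posSemidef ha
  simpa using this.contracts hf.2

theorem Contracts.mono {k : ℕ} {f : Mat k →ₗ[ℂ] Mat k} {κ κ' : ℝ} (hf : Contracts f κ)
    (h : κ ≤ κ') : Contracts f κ' := fun ρ σ hρ hσ =>
  (hf ρ σ hρ hσ).trans (mul_le_mul_of_nonneg_right h (traceNorm_nonneg _))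

theorem Contracts.comp {k : ℕ} {f g : Mat k →ₗ[ℂ] Mat k} {κ κ' : ℝ} (hf : Contracts f κ)
    (hg : Contracts g κ') (hκ : 0 ≤ κ) (hgd : ∀ ρ, IsDensity ρ → IsDensity (g ρ)) :
    Contracts (f ∘ₗ g) (κ * κ') := fun ρ σ hρ hσ =>
  (hf _ _ (hgd ρ hρ) (hgd σ hσ)).trans <| by
    rw [mul_assoc]
    exact mul_le_mul_of_nonneg_left (hg ρ σ hρ hσ) hκ

theorem isCompact_isDensity (k : ℕ) : IsCompact {a : Mat k | IsDensity a} := by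
  have hc : IsCompact (Set.univ.pi fun _ : Fin k => Set.univ.pi fun _ : Fin k =>
      Metric.closedBall (0 : ℂ) 1) :=
    isCompact_univ_pi fun _ => isCompact_univ_pi fun _ => isCompact_closedBall _ _
  refine hc.of_isClosed_subset (isClosed_isDensity k) fun a ha i _ j _ => ?_
  simpa using ha.norm_apply_le i j

theorem isCompact_dotProduct_star_eq_one (k : ℕ) :
    IsCompact {v : Fin k → ℂ | star v ⬝ᵥ v = 1} := by
  have hc : IsCompact (Set.univ.pi fun _ : Fin k => Metric.closedBall (0 : ℂ) 1) :=
    isCompact_univ_pi fun _ => isCompact_closedBall _ _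
  refine hc.of_isClosed_subset (isClosed_eq ?_ continuous_const) fun v hv i _ => ?_
  · exact Continuous.dotProduct continuous_star continuous_id
  · have h1 : ∑ j, ‖v j‖ ^ 2 = 1 := by
      have := congrArg Complex.re hv
      simp only [dotProduct, Pi.star_apply, RCLike.star_def, Complex.conj_mul', Complex.re_sum,
        Complex.one_re] at this
      exact_mod_cast this
    have h2 : ‖v i‖ ^ 2 ≤ 1 :=
      h1 ▸ Finset.single_le_sum (f := fun j => ‖v j‖ ^ 2) (fun j _ => by positivity)
        (Finset.mem_univ i)
    simpa using (sq_le_one_iff₀ (norm_nonneg _)).mp h2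

/-- The continuous function `⟨v, f(ρ) v⟩` is positive on the compact product of states and unit
vectors, hence bounded below by some `ε > 0`; homogeneity in `a` and `v` does the rest. -/
theorem IsStrictPos.exists_minorizes {k : ℕ} {f : Mat k →ₗ[ℂ] Mat k} (hf : IsStrictPos f) :
    ∃ ε : ℝ, 0 < ε ∧ Minorizes f ε := by
  have hfc : Continuous f := f.continuous_of_finiteDimensional
  obtain ⟨ε, hε, hmin⟩ := ((isCompact_isDensity k).prod
    (isCompact_dotProduct_star_eq_one k)).exists_forall_le' (a := (0 : ℝ))
    (f := fun p : Mat k × (Fin k → ℂ) => (star p.2 ⬝ᵥ (f p.1 *ᵥ p.2)).re)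
    (Continuous.continuousOn (Complex.continuous_re.comp
      (Continuous.dotProduct (continuous_star.comp continuous_snd)
        (Continuous.matrix_mulVec (hfc.comp continuous_fst) continuous_snd))))
    (by
      rintro ⟨ρ, v⟩ ⟨hρ, hv⟩
      have hρ0 : ρ ≠ 0 := by
        rintro rfl
        simpa using IsDensity.trace_eq_one hρ
      have hv0 : v ≠ 0 := by
        rintro rfl
        simp at hv
      exact (Complex.pos_iff.mp ((hf ρ (IsDensity.posSemidef hρ) hρ0).dotProduct_mulVec_pos hv0)).1)
  refine ⟨ε, hε, fun a ha => ?_⟩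
  rcases eq_or_ne a 0 with rfl | ha0
  · simpa using Matrix.PosSemidef.zero
  obtain ⟨t, ht⟩ : ∃ t : ℝ, a.trace = t :=
    ⟨a.trace.re, (Complex.ext rfl (by simpa using (Complex.nonneg_iff.mp ha.trace_nonneg).2.symm))⟩
  have htpos : 0 < t := by
    have h1 := ha.trace_nonneg
    have h2 : a.trace ≠ 0 := fun h => ha0 (ha.trace_eq_zero_iff.mp h)
    rw [ht] at h1 h2
    have h1' : 0 ≤ t := by exact_mod_cast h1
    have h2' : t ≠ 0 := by exact_mod_cast h2
    exact lt_of_le_of_ne h1' h2'.symm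
  have htne : (t : ℂ) ≠ 0 := by exact_mod_cast htpos.ne'
  have hfa := hf a ha ha0
  have hρ : IsDensity ((t : ℂ)⁻¹ • a) := by
    rw [isDensity_iff]
    refine ⟨ha.smul (by rw [inv_nonneg]; exact_mod_cast htpos.le), ?_⟩
    rw [Matrix.trace_smul, ht, smul_eq_mul, inv_mul_cancel₀ htne]
  have hH : (((ε : ℂ) * a.trace) • (1 : Mat k)).IsHermitian := by
    rw [ht]
    simp [Matrix.IsHermitian, Matrix.conjTranspose_smul]
  refine Matrix.PosSemidef.of_dotProduct_mulVec_nonneg (hfa.isHermitian.sub hH) fun v => ?_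
  rcases eq_or_ne v 0 with rfl | hv0
  · simp
  have hs0 : (0 : ℂ) < star v ⬝ᵥ v := Matrix.dotProduct_star_self_pos_iff.mpr hv0
  obtain ⟨s, hs⟩ : ∃ s : ℝ, star v ⬝ᵥ v = s :=
    ⟨_, (Complex.ext rfl (by simpa using (Complex.pos_iff.mp hs0).2.symm))⟩
  have hspos : 0 < s := by
    rw [hs] at hs0
    exact_mod_cast hs0
  have hsq : (Real.sqrt s)⁻¹ * (Real.sqrt s)⁻¹ = s⁻¹ := by
    rw [← mul_inv, Real.mul_self_sqrt hspos.le]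
  have hsc : ((Real.sqrt s : ℂ))⁻¹ * ((Real.sqrt s : ℂ))⁻¹ = (s : ℂ)⁻¹ := by exact_mod_cast hsq
  have hstar : star ((Real.sqrt s : ℂ)⁻¹) = (Real.sqrt s : ℂ)⁻¹ := by simp
  have hw : star ((Real.sqrt s : ℂ)⁻¹ • v) ⬝ᵥ ((Real.sqrt s : ℂ)⁻¹ • v) = 1 := by
    rw [star_smul, hstar, smul_dotProduct, dotProduct_smul, smul_smul, hsc, hs, smul_eq_mul,
      inv_mul_cancel₀ (by exact_mod_cast hspos.ne')]
  have hkey := hmin (((t : ℂ)⁻¹ • a), ((Real.sqrt s : ℂ)⁻¹ • v)) ⟨hρ, hw⟩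
  simp only [map_smul] at hkey
  rw [star_smul, hstar, smul_dotProduct, mulVec_smul, dotProduct_smul, smul_smul, hsc,
    smul_mulVec, dotProduct_smul, smul_smul, smul_eq_mul] at hkey
  obtain ⟨r, hr⟩ : ∃ r : ℝ, star v ⬝ᵥ (f a *ᵥ v) = r :=
    ⟨_, (Complex.ext rfl (by
      simpa using (Complex.nonneg_iff.mp (hfa.posSemidef.dotProduct_mulVec_nonneg v)).2.symm))⟩
  rw [sub_mulVec, dotProduct_sub, smul_mulVec, one_mulVec, dotProduct_smul, hs, hr, ht]
  rw [hr] at hkey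
  have hkey' : ε ≤ s⁻¹ * t⁻¹ * r := by
    have : ((s : ℂ)⁻¹ * (t : ℂ)⁻¹ * (r : ℂ)).re = s⁻¹ * t⁻¹ * r := by
      rw [← Complex.ofReal_inv, ← Complex.ofReal_inv, ← Complex.ofReal_mul, ← Complex.ofReal_mul,
        Complex.ofReal_re]
    rwa [this] at hkey
  have : ε * t * s ≤ r := by
    calc ε * t * s ≤ (s⁻¹ * t⁻¹ * r) * t * s := by gcongr
      _ = r := by field_simp
  have h0 : 0 ≤ r - ε * t * s := sub_nonneg.mpr this
  rw [smul_eq_mul]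
  exact_mod_cast h0

end Doeblin

/-! ### Maximal ergodic argument. -/

section MaximalErgodic

open MeasureTheory Filter Topology

/-- The maximal partial Birkhoff sums `max_{0 ≤ i ≤ n} S_i φ`. -/
noncomputable def birkhoffMax {X : Type*} (T : X → X) (φ : X → ℝ) : ℕ → X → ℝ
  | 0 => fun _ => 0
  | n + 1 => fun x => max 0 (φ x + birkhoffMax T φ n (T x))

variable {X : Type*} {T : X → X} {φ : X → ℝ}

theorem birkhoffMax_nonneg (n : ℕ) (x : X) : 0 ≤ birkhoffMax T φ n x := by
  cases n with
  | zero => exact le_rfl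
  | succ n => exact le_max_left _ _

theorem birkhoffMax_le_succ (n : ℕ) : ∀ x, birkhoffMax T φ n x ≤ birkhoffMax T φ (n + 1) x := by
  induction n with
  | zero => exact fun x => birkhoffMax_nonneg _ x
  | succ n ih => exact fun x => max_le_max le_rfl (add_le_add le_rfl (ih (T x)))

theorem monotone_birkhoffMax (x : X) : Monotone fun n => birkhoffMax T φ n x :=
  monotone_nat_of_le_succ fun n => birkhoffMax_le_succ n x

theorem birkhoffSum_le_birkhoffMax (n : ℕ) : ∀ x, birkhoffSum T φ n x ≤ birkhoffMax T φ n x := by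
  induction n with
  | zero => exact fun x => by simp [birkhoffMax]
  | succ n ih =>
    intro x
    rw [birkhoffSum_succ']
    exact (add_le_add le_rfl (ih (T x))).trans (le_max_right _ _)

/-- Makes the boundedness set strictly invariant, so that ergodicity gives a zero-one law. -/
theorem bddAbove_birkhoffMax_comp_iff (x : X) :
    BddAbove (Set.range fun n => birkhoffMax T φ n (T x)) ↔
      BddAbove (Set.range fun n => birkhoffMax T φ n x) := by
  constructor
  · rintro ⟨K, hK⟩
    refine ⟨max 0 (φ x + K), ?_⟩
    rintro _ ⟨n, rfl⟩
    cases n with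
    | zero => exact le_max_left _ _
    | succ n => exact max_le_max le_rfl (add_le_add le_rfl (hK ⟨n, rfl⟩))
  · rintro ⟨K, hK⟩
    refine ⟨K - φ x, ?_⟩
    rintro _ ⟨n, rfl⟩
    have : φ x + birkhoffMax T φ n (T x) ≤ K := (le_max_right _ _).trans (hK ⟨n + 1, rfl⟩)
    show birkhoffMax T φ n (T x) ≤ _
    linarith

theorem birkhoffMax_le {b : ℝ} (hb : ∀ x, |φ x| ≤ b) (n : ℕ) :
    ∀ x, birkhoffMax T φ n x ≤ n * b := by
  induction n with
  | zero => simp [birkhoffMax]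
  | succ n ih =>
    intro x
    have hb0 : 0 ≤ b := (abs_nonneg _).trans (hb x)
    refine max_le (by positivity) ?_
    have := ih (T x)
    have := (abs_le.mp (hb x)).2
    push_cast
    linarith

variable [MeasurableSpace X]

theorem measurable_birkhoffMax (hT : Measurable T) (hφ : Measurable φ) (n : ℕ) :
    Measurable (birkhoffMax T φ n) := by
  induction n with
  | zero => exact measurable_const
  | succ n ih => exact measurable_const.max (hφ.add (ih.comp hT))

/-- A consequence of the maximal ergodic theorem: the Birkhoff sums of a bounded function of
negative mean are almost surely bounded above. -/
theorem Ergodic.ae_bddAbove_birkhoffSum {μ : Measure X} [IsProbabilityMeasure μ]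
    (hT : Ergodic T μ) (hφ : Measurable φ) {b : ℝ} (hb : ∀ x, |φ x| ≤ b)
    (hneg : ∫ x, φ x ∂μ < 0) :
    ∀ᵐ x ∂μ, BddAbove (Set.range fun n => birkhoffSum T φ n x) := by
  have hTm : Measurable T := hT.measurable
  have hM := measurable_birkhoffMax hTm hφ
  have hset : MeasurableSet {x | BddAbove (Set.range fun n => birkhoffMax T φ n x)} :=
    measurableSet_bddAbove_range hM
  have hbnd : ∀ n x, |birkhoffMax T φ n x| ≤ n * b := fun n x => by
    rw [abs_of_nonneg (birkhoffMax_nonneg n x)]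
    exact birkhoffMax_le hb n x
  have hint : ∀ n, Integrable (birkhoffMax T φ n) μ := fun n =>
    Integrable.of_bound (hM n).aestronglyMeasurable (n * b) (ae_of_all _ (hbnd n))
  have hintT : ∀ n, Integrable (fun x => birkhoffMax T φ n (T x)) μ := fun n =>
    Integrable.of_bound ((hM n).comp hTm).aestronglyMeasurable (n * b)
      (ae_of_all _ fun x => hbnd n (T x))
  rcases hT.toPreErgodic.ae_mem_or_ae_notMem hset
    (Set.ext fun x => bddAbove_birkhoffMax_comp_iff x) with h | h
  · filter_upwards [h] with x hx
    obtain ⟨K, hK⟩ := hx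
    refine ⟨K, ?_⟩
    rintro _ ⟨n, rfl⟩
    exact (birkhoffSum_le_birkhoffMax n x).trans (hK ⟨n, rfl⟩)
  · exfalso
    -- Let `M_n` be the maximal sums. The integrand is `M_{n+1} - M_n ∘ T`, whose integral is
    -- nonnegative by invariance and monotonicity. If `M_n → ∞` a.s., it converges to `φ`,
    -- contradicting the negative mean.
    have hdiff : ∀ n, 0 ≤ ∫ x, max (-birkhoffMax T φ n (T x)) (φ x) ∂μ := by
      intro n
      have h1 : ∀ x, max (-birkhoffMax T φ n (T x)) (φ x) =
          birkhoffMax T φ (n + 1) x - birkhoffMax T φ n (T x) := by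
        intro x
        show _ = max 0 (φ x + birkhoffMax T φ n (T x)) - _
        rw [← max_sub_sub_right]
        congr 1 <;> ring
      simp_rw [h1]
      rw [integral_sub (hint _) (hintT n)]
      have h2 : ∫ x, birkhoffMax T φ n (T x) ∂μ = ∫ x, birkhoffMax T φ n x ∂μ := by
        conv_rhs => rw [← hT.toMeasurePreserving.map_eq]
        rw [integral_map hTm.aemeasurable (hM n).aestronglyMeasurable]
      rw [h2, sub_nonneg]
      exact integral_mono (hint n) (hint (n + 1)) (birkhoffMax_le_succ n)
    have hlim : Tendsto (fun n => ∫ x, max (-birkhoffMax T φ n (T x)) (φ x) ∂μ) atTop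
        (𝓝 (∫ x, φ x ∂μ)) := by
      refine tendsto_integral_of_dominated_convergence (fun _ => b)
        (fun n => (((hM n).comp hTm).neg.max hφ).aestronglyMeasurable) (integrable_const b)
        (fun n => ae_of_all _ fun x => ?_) ?_
      · have h1 := abs_le.mp (hb x)
        have h2 := birkhoffMax_nonneg (T := T) (φ := φ) n (T x)
        rw [Real.norm_eq_abs, abs_le]
        refine ⟨h1.1.trans (le_max_right _ _), max_le ?_ h1.2⟩
        linarith [(abs_nonneg _).trans (hb x)]
      · filter_upwards [h] with x hx
        have hx' : ¬ BddAbove (Set.range fun n => birkhoffMax T φ n (T x)) :=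
          fun h' => hx ((bddAbove_birkhoffMax_comp_iff x).mp h')
        have htop := tendsto_atTop_atTop_of_monotone' (monotone_birkhoffMax (T x)) hx'
        refine tendsto_const_nhds.congr' ?_
        filter_upwards [htop.eventually_ge_atTop (-φ x)] with n hn
        exact (max_eq_right (by linarith)).symm
    exact absurd (ge_of_tendsto' hlim hdiff) (not_le.mpr hneg)

end MaximalErgodic

/-! ### Contraction and limits of compositions. -/

section Composition

open MeasureTheory Filter Topology

variable {k : ℕ} {F : ℤ → (Mat k →ₗ[ℂ] Mat k)}

/-- The `+ 1` appears because `compUp F m i` is a product of `i + 1` maps. -/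
theorem compUp_add (F : ℤ → (Mat k →ₗ[ℂ] Mat k)) (m : ℤ) (i j : ℕ) :
    compUp F m (i + 1 + j) = compUp F (m + (i + 1 : ℕ)) j ∘ₗ compUp F m i := by
  induction j with
  | zero => rfl
  | succ j ih =>
    rw [← add_assoc, compUp, ih, compUp, LinearMap.comp_assoc]
    congr 2
    push_cast
    ring

theorem compUp_succ_bot (F : ℤ → (Mat k →ₗ[ℂ] Mat k)) (m : ℤ) (j : ℕ) :
    compUp F m (j + 1) = compUp F (m + 1) j ∘ₗ F m := by
  rw [add_comm j 1]
  exact compUp_add F m 0 j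

theorem compUp_map_isDensity (hF : ∀ i, IsChannel (F i)) (m : ℤ) (j : ℕ) {ρ : Mat k}
    (hρ : IsDensity ρ) : IsDensity (compUp F m j ρ) := by
  induction j with
  | zero => exact (hF m).map_isDensity hρ
  | succ j ih => exact (hF _).map_isDensity ih

theorem compUp_contracts_one (hF : ∀ i, IsChannel (F i)) (m : ℤ) (j : ℕ) :
    Contracts (compUp F m j) 1 := by
  induction j with
  | zero => exact (hF m).contracts_one
  | succ j ih =>
    have := (hF (m + (j + 1 : ℕ))).contracts_one.comp ih zero_le_one
      fun ρ => compUp_map_isDensity hF m j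
    rwa [one_mul] at this

theorem trace_compUp (hF : ∀ i a, (F i a).trace = a.trace) (m : ℤ) (j : ℕ) (a : Mat k) :
    (compUp F m j a).trace = a.trace := by
  induction j with
  | zero => exact hF m a
  | succ j ih => exact (hF _ _).trans ih

/-- If every block of length `N + 1` starting at an index of positive weight contracts by
`exp (-β (N + 1))`, then long compositions contract exponentially in their total weight. -/
theorem compUp_contracts_exp_sum (hF : ∀ i, IsChannel (F i)) {β : ℝ} (hβ : 0 ≤ β) {N : ℕ}
    {w : ℤ → ℝ} (hw1 : ∀ i, w i ≤ 1)
    (hw : ∀ i, 0 < w i → Contracts (compUp F i N) (Real.exp (-β * (N + 1)))) (j : ℕ) :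
    ∀ m : ℤ, Contracts (compUp F m j)
      (Real.exp (-β * (∑ i ∈ Finset.range (j + 1), w (m + i) - N))) := by
  have hsum : ∀ (n : ℕ) (m : ℤ), ∑ i ∈ Finset.range n, w (m + i) ≤ n := fun n m => by
    simpa using Finset.sum_le_sum fun i (_ : i ∈ Finset.range n) => hw1 (m + i)
  -- Greedy selection from the left: if `w m > 0`, remove a whole block, of weight at most `N + 1`;
  -- otherwise drop the index `m`, which has no positive weight. The loss `N` accounts for a final
  -- stretch too short to hold a block.
  induction j using Nat.strong_induction_on with
  | _ j ih =>
    intro m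
    rcases lt_trichotomy j N with hj | rfl | hj
    · refine (compUp_contracts_one hF m j).mono (Real.one_le_exp ?_)
      have h1 := hsum (j + 1) m
      have h2 : ((j + 1 : ℕ) : ℝ) ≤ N := by exact_mod_cast hj
      nlinarith
    all_goals by_cases hm : 0 < w m
    · refine (hw m hm).mono (Real.exp_le_exp.mpr ?_)
      have h1 := hsum (j + 1) m
      push_cast at h1
      nlinarith [(Nat.cast_nonneg j : (0 : ℝ) ≤ j)]
    · refine (compUp_contracts_one hF m j).mono (Real.one_le_exp ?_)
      have h1 := hsum j (m + 1)
      rw [Finset.sum_range_succ']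
      push_cast at h1 ⊢
      simp only [add_assoc, add_comm (1 : ℤ), add_zero] at h1 ⊢
      nlinarith
    · obtain ⟨i, rfl⟩ : ∃ i, j = N + 1 + i := ⟨j - (N + 1), by omega⟩
      rw [compUp_add]
      refine ((ih i (by omega) _).comp (hw m hm) (Real.exp_pos _).le
        fun ρ => compUp_map_isDensity hF m N).mono ?_
      rw [← Real.exp_add]
      refine Real.exp_le_exp.mpr ?_
      rw [add_assoc (N + 1) i 1, Finset.sum_range_add _ (N + 1) (i + 1)]
      have h1 := hsum (N + 1) m
      push_cast at h1 ⊢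
      simp only [add_assoc] at h1 ⊢
      nlinarith
    · obtain ⟨i, rfl⟩ : ∃ i, j = i + 1 := ⟨j - 1, by omega⟩
      rw [compUp_succ_bot]
      refine ((ih i (by omega) (m + 1)).comp (hF m).contracts_one (Real.exp_pos _).le
        fun ρ => (hF m).map_isDensity).mono ?_
      rw [mul_one]
      refine Real.exp_le_exp.mpr ?_
      rw [Finset.sum_range_succ' _ (i + 1)]
      push_cast
      simp only [add_assoc, add_comm (1 : ℤ), add_zero]
      nlinarith

/-- The compositions `F n ∘ ⋯ ∘ F (n - j)` converge to a density matrix as soon as they contract. -/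
theorem exists_tendsto_compUp (hF : ∀ i, IsChannel (F i)) (n : ℤ) {κ : ℕ → ℝ}
    (hκ : Tendsto κ atTop (𝓝 0)) (hc : ∀ j : ℕ, Contracts (compUp F (n - j) j) (κ j))
    {ρ : Mat k} (hρ : IsDensity ρ) :
    ∃ g, IsDensity g ∧ Tendsto (fun j : ℕ => compUp F (n - j) j ρ) atTop (𝓝 g) := by
  have hd : ∀ j : ℕ, IsDensity (compUp F (n - j) j ρ) := fun j => compUp_map_isDensity hF _ _ hρ
  -- The earlier maps only replace `ρ` by another state `σ`, so contraction makes the sequence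
  -- Cauchy.
  have hfac : ∀ j l : ℕ, j ≤ l → ∃ σ, IsDensity σ ∧
      compUp F (n - l) l ρ = compUp F (n - j) j σ := by
    intro j l hjl
    obtain rfl | hlt := hjl.eq_or_lt
    · exact ⟨ρ, hρ, rfl⟩
    obtain ⟨i, rfl⟩ : ∃ i, l = i + 1 + j := ⟨l - j - 1, by omega⟩
    refine ⟨_, compUp_map_isDensity hF (n - (i + 1 + j : ℕ)) i hρ, ?_⟩
    rw [compUp_add, LinearMap.comp_apply]
    congr 2
    push_cast
    ring
  have hdist : ∀ j l : ℕ, j ≤ l → ∀ a b,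
      dist (compUp F (n - l) l ρ a b) (compUp F (n - j) j ρ a b) ≤ 2 * |κ j| := by
    intro j l hjl a b
    obtain ⟨σ, hσ, hl⟩ := hfac j l hjl
    have hH := (hd l).posSemidef.isHermitian.sub (hd j).posSemidef.isHermitian
    rw [dist_eq_norm, ← Matrix.sub_apply]
    refine (norm_apply_le_traceNorm hH a b).trans ?_
    rw [hl]
    refine (((hc j).mono (le_abs_self _)) σ ρ hσ hρ).trans ?_
    rw [mul_comm]
    exact mul_le_mul_of_nonneg_right (hσ.traceNorm_sub_le hρ) (abs_nonneg _)
  have hlim : ∀ a b, ∃ c, Tendsto (fun j : ℕ => compUp F (n - j) j ρ a b) atTop (𝓝 c) := by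
    intro a b
    refine cauchySeq_tendsto_of_complete (cauchySeq_of_le_tendsto_0' (fun j => 2 * |κ j|) ?_ ?_)
    · intro j l hjl
      rw [dist_comm]
      exact hdist j l hjl a b
    · simpa using hκ.abs.const_mul 2
  choose c hc' using hlim
  have ht : Tendsto (fun j : ℕ => compUp F (n - j) j ρ) atTop (𝓝 (Matrix.of c)) :=
    tendsto_pi_nhds.mpr fun a => tendsto_pi_nhds.mpr fun b => hc' a b
  exact ⟨_, (isClosed_isDensity k).mem_of_tendsto ht (Eventually.of_forall hd), ht⟩

/-- The limits of `F n ∘ ⋯ ∘ F (n - j)` are carried to one another by the maps `F`. -/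
theorem compUp_apply_eq_of_tendsto {g : ℤ → Mat k} {ρ : Mat k}
    (hg : ∀ n : ℤ, Tendsto (fun j : ℕ => compUp F (n - j) j ρ) atTop (𝓝 (g n))) (m : ℤ) (j : ℕ) :
    compUp F m j (g (m - 1)) = g (m + j) := by
  have hstep : ∀ n, F n (g (n - 1)) = g n := by
    intro n
    have h1 := ((F n).continuous_of_finiteDimensional.tendsto _).comp (hg (n - 1))
    refine tendsto_nhds_unique h1 (((tendsto_add_atTop_iff_nat 1).mpr (hg n)).congr fun i => ?_)
    have e1 : n - ((i + 1 : ℕ) : ℤ) = n - 1 - i := by push_cast; ring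
    have e2 : n - 1 - (i : ℤ) + (i + 1 : ℕ) = n := by push_cast; ring
    rw [e1, compUp, e2]
    rfl
  induction j with
  | zero => rw [Nat.cast_zero, add_zero]; exact hstep m
  | succ j ih =>
    rw [compUp, LinearMap.comp_apply, ih]
    convert hstep (m + (j + 1 : ℕ)) using 3
    push_cast; ring

end Composition

/-! ### Measurability. -/

section Measurability

variable {X : Type*} [MeasurableSpace X] {k : ℕ}

theorem MatMeasurable.map {f : X → (Mat k →ₗ[ℂ] Mat k)} (hf : MapMeasurable f) {h : X → Mat k}
    (hh : MatMeasurable h) : MatMeasurable fun x => f x (h x) := by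
  intro i j
  have : ∀ x, f x (h x) i j = ∑ a, ∑ b, h x a b * f x (Matrix.single a b 1) i j := by
    intro x
    conv_lhs => rw [Matrix.matrix_eq_sum_single (h x)]
    have h1 : ∀ a b, Matrix.single a b (h x a b) = h x a b • Matrix.single a b (1 : ℂ) :=
      fun a b => by rw [Matrix.smul_single, smul_eq_mul, mul_one]
    simp only [h1, map_sum, map_smul, Matrix.sum_apply, Matrix.smul_apply, smul_eq_mul]
  simp_rw [this]
  exact Finset.measurable_sum _ fun a _ => Finset.measurable_sum _ fun b _ =>
    (hh a b).mul (hf _ i j)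

theorem MapMeasurable.compUp {f : ℤ → X → (Mat k →ₗ[ℂ] Mat k)} (hf : ∀ n, MapMeasurable (f n))
    (m : ℤ) (j : ℕ) : MapMeasurable fun x => compUp (fun n => f n x) m j := by
  induction j with
  | zero => exact hf m
  | succ j ih => exact fun a => MatMeasurable.map (hf _) (ih a)

/-- For fixed `ε` the condition is closed in the finitely many coefficients of the map, even though
it is an uncountable intersection over `A`. -/
theorem MapMeasurable.measurableSet_minorizes {f : X → (Mat k →ₗ[ℂ] Mat k)} (hf : MapMeasurable f)
    (ε : ℝ) : MeasurableSet {x | Minorizes (f x) ε} := by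
  set Φ : X → (Fin k → Fin k → Fin k → Fin k → ℂ) :=
    fun x a b i j => f x (Matrix.single a b 1) i j with hΦ
  have hΦm : Measurable Φ := by
    refine measurable_pi_iff.mpr fun a => measurable_pi_iff.mpr fun b => measurable_pi_iff.mpr
      fun i => measurable_pi_iff.mpr fun j => hf _ i j
  let ev : Mat k → (Fin k → Fin k → Fin k → Fin k → ℂ) → Mat k := fun A t =>
    Matrix.of (fun i j => ∑ a, ∑ b, A a b * t a b i j) - ((ε : ℂ) * A.trace) • (1 : Mat k)
  have hev : ∀ A, Continuous (ev A) := fun A => by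
    refine Continuous.sub (continuous_pi fun i => continuous_pi fun j => ?_) continuous_const
    show Continuous fun t : Fin k → Fin k → Fin k → Fin k → ℂ => ∑ a, ∑ b, A a b * t a b i j
    fun_prop
  have hclosed : IsClosed (⋂ A ∈ {A : Mat k | A.PosSemidef}, ev A ⁻¹' {B | B.PosSemidef}) :=
    isClosed_biInter fun A _ => (isClosed_posSemidef k).preimage (hev A)
  have : BorelSpace (Fin k → Fin k → ℂ) := Pi.borelSpace
  have : BorelSpace (Fin k → Fin k → Fin k → ℂ) := Pi.borelSpace
  have : OpensMeasurableSpace (Fin k → Fin k → Fin k → Fin k → ℂ) := Pi.opensMeasurableSpace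
  have hms := hΦm hclosed.measurableSet
  convert hms using 1
  ext x
  have h1 : ∀ A : Mat k, ev A (Φ x) = f x A - ((ε : ℂ) * A.trace) • (1 : Mat k) := by
    intro A
    show Matrix.of _ - _ = _
    congr 1
    conv_rhs => rw [Matrix.matrix_eq_sum_single A]
    have h1 : ∀ a b, Matrix.single a b (A a b) = A a b • Matrix.single a b (1 : ℂ) :=
      fun a b => by rw [Matrix.smul_single, smul_eq_mul, mul_one]
    ext i j
    simp only [h1, map_sum, map_smul, Matrix.sum_apply, Matrix.smul_apply, smul_eq_mul,
      Matrix.of_apply, hΦ]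
  simp [Minorizes, h1]

end Measurability

/-! ### Shifts along two-sided orbits. -/

section Orbits

open MeasureTheory Filter Topology

variable {X : Type*} [MeasurableSpace X] {T : X ≃ᵐ X}

theorem MeasurableEquiv.zpow_natCast_apply (n : ℕ) (x : X) :
    (T.toEquiv ^ (n : ℤ) : Equiv.Perm X) x = T^[n] x := by
  rw [zpow_natCast, ← Equiv.Perm.iterate_eq_pow]
  rfl

theorem MeasurableEquiv.zpow_neg_natCast_apply (n : ℕ) (x : X) :
    (T.toEquiv ^ (-(n : ℤ)) : Equiv.Perm X) x = T.symm^[n] x := by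
  rw [zpow_neg, ← inv_zpow, zpow_natCast, ← Equiv.Perm.iterate_eq_pow]
  rfl

theorem MeasurableEquiv.measurePreserving_zpow {P : Measure X} (hT : MeasurePreserving T P P)
    (n : ℤ) : MeasurePreserving (T.toEquiv ^ n : Equiv.Perm X) P P := by
  obtain ⟨i, rfl | rfl⟩ := n.eq_nat_or_neg
  · rw [show ⇑(T.toEquiv ^ (i : ℤ) : Equiv.Perm X) = T^[i] from
      funext (MeasurableEquiv.zpow_natCast_apply i)]
    exact hT.iterate i
  · rw [show ⇑(T.toEquiv ^ (-(i : ℤ)) : Equiv.Perm X) = T.symm^[i] from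
      funext (MeasurableEquiv.zpow_neg_natCast_apply i)]
    exact (MeasurePreserving.symm T hT).iterate i

theorem MeasurableEquiv.measurable_zpow (n : ℤ) : Measurable (T.toEquiv ^ n : Equiv.Perm X) := by
  obtain ⟨i, rfl | rfl⟩ := n.eq_nat_or_neg
  · rw [show ⇑(T.toEquiv ^ (i : ℤ) : Equiv.Perm X) = T^[i] from
      funext (MeasurableEquiv.zpow_natCast_apply i)]
    exact T.measurable.iterate i
  · rw [show ⇑(T.toEquiv ^ (-(i : ℤ)) : Equiv.Perm X) = T.symm^[i] from
      funext (MeasurableEquiv.zpow_neg_natCast_apply i)]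
    exact T.symm.measurable.iterate i

theorem MeasurableEquiv.zpow_zpow_apply (m n : ℤ) (x : X) :
    (T.toEquiv ^ m : Equiv.Perm X) ((T.toEquiv ^ n : Equiv.Perm X) x) =
      (T.toEquiv ^ (m + n) : Equiv.Perm X) x := by
  rw [zpow_add, Equiv.Perm.mul_apply]

theorem orbitSeq_zpow_apply {Y : Type*} (h : X → Y) (m n : ℤ) (x : X) :
    orbitSeq T h m ((T.toEquiv ^ n : Equiv.Perm X) x) = orbitSeq T h (m + n) x := by
  rw [orbitSeq, MeasurableEquiv.zpow_zpow_apply, orbitSeq]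

theorem MapMeasurable.orbitSeq {k : ℕ} {f : X → (Mat k →ₗ[ℂ] Mat k)} (hf : MapMeasurable f)
    (n : ℤ) : MapMeasurable (orbitSeq T f n) := fun a i j =>
  (hf a i j).comp (MeasurableEquiv.measurable_zpow n)

theorem compUp_shift {k : ℕ} (F : ℤ → (Mat k →ₗ[ℂ] Mat k)) (i m : ℤ) (j : ℕ) :
    compUp (fun n => F (n + i)) m j = compUp F (m + i) j := by
  induction j with
  | zero => rfl
  | succ j ih => rw [compUp, compUp, ih, add_right_comm]

theorem compUp_orbitSeq_zpow_apply {k : ℕ} (f : X → (Mat k →ₗ[ℂ] Mat k)) (x : X) (i m : ℤ)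
    (j : ℕ) :
    compUp (fun n => orbitSeq T f n ((T.toEquiv ^ i : Equiv.Perm X) x)) m j =
      compUp (fun n => orbitSeq T f n x) (m + i) j := by
  simp_rw [orbitSeq_zpow_apply]
  exact compUp_shift (fun n => orbitSeq T f n x) i m j

/-- A sum along the orbit of `x` over an interval splits into a backward and a forward Birkhoff sum
started at an intermediate time `z`. -/
theorem sum_range_zpow_eq_birkhoffSum (φ : X → ℝ) (x : X) (z : ℤ) (a b : ℕ) :
    ∑ i ∈ Finset.range (a + b), φ ((T.toEquiv ^ (z - a + i) : Equiv.Perm X) x) =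
      birkhoffSum T.symm (φ ∘ T.symm) a ((T.toEquiv ^ z : Equiv.Perm X) x) +
        birkhoffSum T φ b ((T.toEquiv ^ z : Equiv.Perm X) x) := by
  rw [Finset.sum_range_add, ← Finset.sum_range_reflect, birkhoffSum, birkhoffSum]
  congr 1
  -- The backward term `i` sits at time `z - 1 - i`, hence `φ ∘ T.symm`; time `z` is counted only in
  -- the forward sum.
  · refine Finset.sum_congr rfl fun i hi => ?_
    have hi' : i < a := Finset.mem_range.mp hi
    rw [Function.comp_apply, ← Function.iterate_succ_apply' T.symm,
      ← MeasurableEquiv.zpow_neg_natCast_apply, MeasurableEquiv.zpow_zpow_apply]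
    congr 3
    rw [Nat.sub_sub, Nat.cast_sub (by omega)]
    push_cast
    ring
  · refine Finset.sum_congr rfl fun i _ => ?_
    rw [← MeasurableEquiv.zpow_natCast_apply, MeasurableEquiv.zpow_zpow_apply]
    congr 3
    push_cast
    ring

theorem measurable_birkhoffSum {S : X → X} (hS : Measurable S) {φ : X → ℝ} (hφ : Measurable φ)
    (n : ℕ) : Measurable (birkhoffSum S φ n) :=
  Finset.measurable_sum _ fun i _ => hφ.comp (hS.iterate i)

end Orbits

/-! ### Contraction along an orbit and the stationary state. -/

section MainTheorem

open MeasureTheory Filter Topology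

variable {X : Type*} [MeasurableSpace X] {T : X ≃ᵐ X} {k : ℕ} {f₀ : X → (Mat k →ₗ[ℂ] Mat k)}

/-- The strict positivity event is covered by the countably many events with `ε = 1/(n + 1)`; null
sets suffice, so its own measurability is not needed. -/
theorem exists_pos_measure_minorizes {P : Measure X} {h : X → (Mat k →ₗ[ℂ] Mat k)}
    (hpos : 0 < P {x | IsStrictPos (h x)}) :
    ∃ ε : ℝ, 0 < ε ∧ 0 < P {x | Minorizes (h x) ε} := by
  by_contra! hcon
  refine hpos.ne' (measure_mono_null (t := ⋃ n : ℕ, {x | Minorizes (h x) (1 / ((n : ℝ) + 1))})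
    (fun x hx => ?_) (measure_iUnion_null fun n =>
      le_antisymm (hcon _ Nat.one_div_pos_of_nat) bot_le))
  obtain ⟨ε, hε, hm⟩ := IsStrictPos.exists_minorizes hx
  obtain ⟨n, hn⟩ := exists_nat_one_div_lt hε
  refine Set.mem_iUnion.mpr ⟨n, fun a ha => ?_⟩
  have h1 := (hm a ha).add (Matrix.PosSemidef.one.smul
    (a := ((ε - 1 / ((n : ℝ) + 1) : ℝ) : ℂ) * a.trace)
    (mul_nonneg (by exact_mod_cast (sub_nonneg.mpr hn.le)) ha.trace_nonneg))
  convert h1 using 1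
  rw [sub_add, ← sub_smul, ← sub_mul]
  push_cast
  congr 3
  ring

/-- The composition over `[z - a, z + b]` contracts exponentially, up to an error controlled by the
backward and forward Birkhoff sums of `c - 1_A` at time `z`. -/
theorem compUp_orbitSeq_contracts (hchan : ∀ x, IsChannel (f₀ x)) {N : ℕ} {ε : ℝ} (hε : 0 ≤ ε)
    {φ : X → ℝ} {c β : ℝ} (hβ : β = k * ε / (N + 1))
    (hφ : φ = fun x => c - Set.indicator
      {x | Minorizes (compUp (fun n => orbitSeq T f₀ n x) 0 N) ε} 1 x)
    (x : X) (z : ℤ) (a b : ℕ) :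
    Contracts (compUp (fun n => orbitSeq T f₀ n x) (z - a) (a + b))
      (Real.exp (β * (N + birkhoffSum T.symm (φ ∘ T.symm) a ((T.toEquiv ^ z : Equiv.Perm X) x) +
        birkhoffSum T φ (b + 1) ((T.toEquiv ^ z : Equiv.Perm X) x))) *
          Real.exp (-(β * c) * (a + b + 1))) := by
  set A : Set X := {x | Minorizes (compUp (fun n => orbitSeq T f₀ n x) 0 N) ε} with hA
  set w : ℤ → ℝ := fun i => Set.indicator A 1 ((T.toEquiv ^ i : Equiv.Perm X) x) with hw
  have hF : ∀ i, IsChannel (orbitSeq T f₀ i x) := fun i => hchan _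
  have hw1 : ∀ i, w i ≤ 1 := fun i => Set.indicator_le_self' (by simp) _
  have hblock : ∀ i, 0 < w i →
      Contracts (compUp (fun n => orbitSeq T f₀ n x) i N) (Real.exp (-β * (N + 1))) := by
    intro i hi
    have hmem : (T.toEquiv ^ i : Equiv.Perm X) x ∈ A := Set.mem_of_indicator_ne_zero hi.ne'
    rw [hA, Set.mem_ofPred_eq, compUp_orbitSeq_zpow_apply, zero_add] at hmem
    refine (hmem.contracts (trace_compUp (fun i => (hF i).2) i N)).mono ?_
    -- This choice of `β` makes the block factor `exp(-kε) ≥ 1 - kε`.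
    have : -β * (N + 1) = -(k * ε) := by
      rw [hβ]
      field_simp
    rw [this]
    linarith [Real.add_one_le_exp (-(k * ε))]
  refine (compUp_contracts_exp_sum hF (by rw [hβ]; positivity) hw1 hblock (a + b) (z - a)).mono ?_
  rw [← Real.exp_add, add_assoc (N : ℝ), ← sum_range_zpow_eq_birkhoffSum, ← add_assoc a b 1, hφ,
    Finset.sum_sub_distrib, Finset.sum_const, Finset.card_range]
  refine Real.exp_le_exp.mpr (le_of_eq ?_)
  ring

theorem MatMeasurable.ite {g h : X → Mat k} (hg : MatMeasurable g) (hh : MatMeasurable h)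
    {s : Set X} (hs : MeasurableSet s) [DecidablePred (· ∈ s)] :
    MatMeasurable fun x => if x ∈ s then g x else h x := by
  intro i j
  have : (fun x => (if x ∈ s then g x else h x) i j) = fun x => if x ∈ s then g x i j else h x i j := by
    funext x
    split_ifs <;> rfl
  rw [this]
  exact Measurable.ite hs (hg i j) (hh i j)

open Classical in
/-- The stationary limit state `g₀ = lim f₀ ∘ ⋯ ∘ f_{-j}` on an invariant set of convergence. -/
theorem exists_stationary_state (hk : 0 < k) (hf₀ : MapMeasurable f₀)
    (hchan : ∀ x, IsChannel (f₀ x)) {Ω : Set X} (hΩ : MeasurableSet Ω)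
    (hinv : ∀ x ∈ Ω, ∀ n : ℤ, (T.toEquiv ^ n : Equiv.Perm X) x ∈ Ω) {κ : X → ℕ → ℝ}
    (hκ : ∀ x ∈ Ω, Tendsto (κ x) atTop (𝓝 0))
    (hc : ∀ x ∈ Ω, ∀ j : ℕ, Contracts (compUp (fun n => orbitSeq T f₀ n x) (0 - j) j) (κ x j)) :
    ∃ g₀ : X → Mat k, MatMeasurable g₀ ∧ (∀ x, IsDensity (g₀ x)) ∧
      ∀ x ∈ Ω, ∀ (m : ℤ) (j : ℕ), compUp (fun n => orbitSeq T f₀ n x) m j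
        (orbitSeq T g₀ (m - 1) x) = orbitSeq T g₀ (m + j) x := by
  set ρ₀ : Mat k := (k : ℂ)⁻¹ • 1 with hρ₀
  have hd := isDensity_maximallyMixed hk
  -- The constant value off `Ω` makes the limit exist, measurably and as a state, at every point.
  let G : ℕ → X → Mat k := fun j x =>
    if x ∈ Ω then compUp (fun n => orbitSeq T f₀ n x) (0 - j) j ρ₀ else ρ₀
  have hG : ∀ j, MatMeasurable (G j) := fun j =>
    MatMeasurable.ite (MapMeasurable.compUp (fun n => hf₀.orbitSeq (T := T) n) (0 - j) j ρ₀)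
      (h := fun _ => ρ₀) (fun _ _ => measurable_const) hΩ
  have hlim : ∀ x, ∃ g, IsDensity g ∧ Tendsto (fun j => G j x) atTop (𝓝 g) := by
    intro x
    by_cases hx : x ∈ Ω
    · simp only [G, if_pos hx]
      exact exists_tendsto_compUp (fun i => hchan _) 0 (hκ x hx) (hc x hx) hd
    · simp only [G, if_neg hx]
      exact ⟨ρ₀, hd, tendsto_const_nhds⟩
  choose g₀ hg₀ ht using hlim
  refine ⟨g₀, fun i j => ?_, hg₀, fun x hx m j => ?_⟩
  · exact measurable_of_tendsto_metrizable (fun l => hG l i j) (tendsto_pi_nhds.mpr fun x =>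
      ((tendsto_pi_nhds.mp ((tendsto_pi_nhds.mp (ht x)) i)) j))
  · refine compUp_apply_eq_of_tendsto (F := fun n => orbitSeq T f₀ n x)
      (g := fun n => orbitSeq T g₀ n x) (ρ := ρ₀) (fun n => ?_) m j
    have h1 := ht ((T.toEquiv ^ n : Equiv.Perm X) x)
    simp only [G, if_pos (hinv x hx n), compUp_orbitSeq_zpow_apply] at h1
    refine h1.congr fun j => ?_
    rw [zero_sub, neg_add_eq_sub]

end MainTheorem

/-! ### The main estimate. -/

open MeasureTheory Filter Topology in
theorem mainTheorem2 {X : Type*} [MeasurableSpace X] (P : MeasureTheory.Measure X)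
    [MeasureTheory.IsProbabilityMeasure P] (T : X ≃ᵐ X) (hT : Ergodic T P)
    (k : ℕ) (hk : 0 < k)
    (f₀ : X → (Mat k →ₗ[ℂ] Mat k)) (hf₀ : MapMeasurable f₀) (hchan : ∀ x, IsChannel (f₀ x))
    (N : ℕ) (hN : 0 < N)
    (hpos : 0 < P {x | IsStrictPos (compRange (fun n => orbitSeq T f₀ n x) (N : ℤ) 0)})
    (hker : P {x | {a : Mat k | dualMap (f₀ x) a = 0} ∩ {a : Mat k | a.PosSemidef} = {0}} = 1) :
    ∃ α : ℝ, 0 < α ∧ ∃ g₀ : X → Mat k, MatMeasurable g₀ ∧ (∀ x, IsDensity (g₀ x)) ∧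
      ∃ C : ℤ → X → ENNReal, (∀ z, Measurable (C z)) ∧ (∀ z, ∀ᵐ x ∂P, C z x < ⊤) ∧
        ∀ m z n : ℤ, m < n → m ≤ z → z ≤ n → ∀ x : X, ∀ ρ : Mat k, IsDensity ρ →
          ENNReal.ofReal
              (traceNorm (compRange (fun i => orbitSeq T f₀ i x) n m ρ - orbitSeq T g₀ n x)) ≤
            C z x * ENNReal.ofReal (Real.exp (-α * ((n - m : ℤ) : ℝ))) := by
  classical
  simp only [compRange, sub_zero, Int.toNat_natCast] at hpos
  obtain ⟨ε, hε, hposA⟩ := exists_pos_measure_minorizes hpos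
  set A : Set X := {x | Minorizes (compUp (fun n => orbitSeq T f₀ n x) 0 N) ε} with hA
  have hAm : MeasurableSet A :=
    (MapMeasurable.compUp (fun n => hf₀.orbitSeq (T := T) n) 0 N).measurableSet_minorizes ε
  have hPA : 0 < P.real A := ENNReal.toReal_pos hposA.ne' (measure_ne_top _ _)
  -- Any `c` strictly between `0` and `P(A)` would give a positive rate and negative mean of `φ`.
  set c : ℝ := P.real A / 2 with hc
  have hc0 : 0 < c := half_pos hPA
  obtain ⟨β, hβ⟩ : ∃ β : ℝ, β = k * ε / (N + 1) := ⟨_, rfl⟩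
  have hβ0 : 0 < β := by
    have : (0 : ℝ) < k := by exact_mod_cast hk
    rw [hβ]
    positivity
  obtain ⟨φ, hφ⟩ : ∃ φ : X → ℝ, φ = fun x => c - A.indicator 1 x := ⟨_, rfl⟩
  have hind : Measurable (A.indicator (1 : X → ℝ)) := measurable_one.indicator hAm
  have hφm : Measurable φ := hφ ▸ measurable_const.sub hind
  have hind01 : ∀ x, 0 ≤ A.indicator (1 : X → ℝ) x ∧ A.indicator (1 : X → ℝ) x ≤ 1 := fun x =>
    ⟨Set.indicator_nonneg (by simp) x, Set.indicator_le_self' (by simp) x⟩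
  have hφle : ∀ x, φ x ≤ c := fun x => by
    rw [hφ]
    exact sub_le_self _ (hind01 x).1
  have hφb : ∀ x, |φ x| ≤ c + 1 := fun x => by
    have := hind01 x
    rw [hφ, abs_le]
    constructor <;> linarith
  have hφint : ∫ x, φ x ∂P < 0 := by
    have hi : Integrable (A.indicator (1 : X → ℝ)) P := (integrable_const (1 : ℝ)).indicator hAm
    rw [hφ, integral_sub (integrable_const c) hi, integral_const, integral_indicator_one hAm]
    simp only [probReal_univ, smul_eq_mul]
    linarith
  set Sf : ℕ → X → ℝ := birkhoffSum T φ with hSf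
  set Sb : ℕ → X → ℝ := birkhoffSum T.symm (φ ∘ T.symm) with hSb
  have hSfm : ∀ n, Measurable (Sf n) := measurable_birkhoffSum T.measurable hφm
  have hSbm : ∀ n, Measurable (Sb n) :=
    measurable_birkhoffSum T.symm.measurable (hφm.comp T.symm.measurable)
  have hforw : ∀ᵐ x ∂P, BddAbove (Set.range fun n => Sf n x) :=
    hT.ae_bddAbove_birkhoffSum hφm hφb hφint
  have hback : ∀ᵐ x ∂P, BddAbove (Set.range fun n => Sb n x) := by
    refine hT.symm.ae_bddAbove_birkhoffSum (hφm.comp T.symm.measurable) (fun x => hφb _) ?_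
    exact (hT.symm.toMeasurePreserving.integral_comp' (f := T.symm) φ).trans_lt hφint
  have hcontr : ∀ (x : X) (z : ℤ) (a b : ℕ),
      Contracts (compUp (fun n => orbitSeq T f₀ n x) (z - a) (a + b))
        (Real.exp (β * (N + Sb a ((T.toEquiv ^ z : Equiv.Perm X) x) +
          Sf (b + 1) ((T.toEquiv ^ z : Equiv.Perm X) x))) *
            Real.exp (-(β * c) * (a + b + 1))) :=
    compUp_orbitSeq_contracts hchan hε.le hβ hφ
  -- Quantifying over all times makes `Ω` exactly invariant. Backward sums alone control the limits
  -- defining `g_n`.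
  set Ω : Set X :=
    {x | ∀ n : ℤ, BddAbove (Set.range fun i => Sb i ((T.toEquiv ^ n : Equiv.Perm X) x))} with hΩ
  have hΩm : MeasurableSet Ω := by
    rw [hΩ, Set.ofPred_forall]
    exact MeasurableSet.iInter fun n =>
      measurableSet_bddAbove_range fun i => (hSbm i).comp (MeasurableEquiv.measurable_zpow n)
  have hτ : ∀ {p : X → Prop} (n : ℤ), (∀ᵐ x ∂P, p x) →
      ∀ᵐ x ∂P, p ((T.toEquiv ^ n : Equiv.Perm X) x) := fun n h =>
    (MeasurableEquiv.measurePreserving_zpow hT.toMeasurePreserving n).quasiMeasurePreserving.ae h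
  have hΩae : ∀ᵐ x ∂P, x ∈ Ω := ae_all_iff.mpr fun n => hτ n hback
  have hΩinv : ∀ x ∈ Ω, ∀ n : ℤ, (T.toEquiv ^ n : Equiv.Perm X) x ∈ Ω := fun x hx n i => by
    simp_rw [MeasurableEquiv.zpow_zpow_apply]
    exact hx _
  have hK : ∀ x : X, ∃ K : ℝ, x ∈ Ω → ∀ j, Sb j x ≤ K := by
    intro x
    by_cases hx : x ∈ Ω
    · obtain ⟨K, hK⟩ := hx 0
      exact ⟨K, fun _ j => hK ⟨j, rfl⟩⟩
    · exact ⟨0, fun h => absurd h hx⟩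
  choose K hK using hK
  obtain ⟨g₀, hg₀m, hg₀d, hg₀⟩ := exists_stationary_state hk hf₀ hchan hΩm hΩinv
    (κ := fun x j => Real.exp (β * (N + K x + c)) * Real.exp (-(β * c) * (j + 1)))
    (fun x _ => by
      have h1 : Tendsto (fun j : ℕ => -(β * c) * ((j : ℝ) + 1)) atTop atBot :=
        (tendsto_atTop_add_const_right _ _ tendsto_natCast_atTop_atTop).const_mul_atTop_of_neg
          (neg_neg_of_pos (mul_pos hβ0 hc0))
      simpa using (Real.tendsto_exp_atBot.comp h1).const_mul (Real.exp (β * (N + K x + c))))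
    -- Take `z = 0`, `b = 0`: the forward sum is the single term `φ x ≤ c`.
    (fun x hx j => by
      have h1 := hcontr x 0 j 0
      simp only [zpow_zero, Equiv.Perm.one_apply, Nat.cast_zero, add_zero, zero_add] at h1
      refine h1.mono ?_
      have h2 := hK x hx j
      have h3 : Sf 1 x ≤ c := by
        rw [hSf, birkhoffSum_one]
        exact hφle x
      gcongr)
  -- The countable supremum is measurable, and `⊤` off `Ω` makes the bound hold at every point.
  -- Forward boundedness enters only in the a.s. finiteness.
  refine ⟨β * c, mul_pos hβ0 hc0, g₀, hg₀m, hg₀d, fun z x => if x ∈ Ω then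
    ⨆ a : ℕ, ⨆ b : ℕ, ENNReal.ofReal (2 * Real.exp (β * (N +
      Sb a ((T.toEquiv ^ z : Equiv.Perm X) x) + Sf b ((T.toEquiv ^ z : Equiv.Perm X) x))))
    else ⊤, fun z => ?_, fun z => ?_, ?_⟩
  · have hz := MeasurableEquiv.measurable_zpow (T := T) z
    refine Measurable.ite hΩm (Measurable.iSup fun a => Measurable.iSup fun b => ?_)
      measurable_const
    exact ENNReal.measurable_ofReal.comp (measurable_const.mul (Real.measurable_exp.comp
      (measurable_const.mul ((measurable_const.add ((hSbm a).comp hz)).add ((hSfm b).comp hz)))))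
  · filter_upwards [hΩae, hτ z hforw] with x hx hxf
    rw [if_pos hx]
    obtain ⟨Kf, hKf⟩ := hxf
    refine lt_of_le_of_lt (iSup_le fun a => iSup_le fun b => ENNReal.ofReal_le_ofReal ?_)
      (ENNReal.ofReal_lt_top (r := 2 * Real.exp (β * (N +
        K ((T.toEquiv ^ z : Equiv.Perm X) x) + Kf))))
    have h1 := hK _ (hΩinv x hx z) a
    have h2 : Sf b ((T.toEquiv ^ z : Equiv.Perm X) x) ≤ Kf := hKf ⟨b, rfl⟩
    gcongr
  · intro m z n hmn hmz hzn x ρ hρ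
    beta_reduce
    by_cases hx : x ∈ Ω
    swap
    · rw [if_neg hx, ENNReal.top_mul (ENNReal.ofReal_pos.mpr (Real.exp_pos _)).ne']
      exact le_top
    obtain ⟨a, ha⟩ := Int.eq_ofNat_of_zero_le (sub_nonneg.mpr hmz)
    obtain ⟨b, hb⟩ := Int.eq_ofNat_of_zero_le (sub_nonneg.mpr hzn)
    obtain rfl : m = z - a := by omega
    obtain rfl : n = z + b := by omega
    have hlen : (z + b - (z - a) : ℤ) = ((a + b : ℕ) : ℤ) := by push_cast; ring
    have hend : (z - a + ((a + b : ℕ) : ℤ) : ℤ) = z + b := by push_cast; ring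
    rw [if_pos hx, compRange, hlen, Int.toNat_natCast, ← hend, ← hg₀ x hx, Int.cast_natCast]
    refine le_trans ?_ (mul_le_mul_left (le_iSup_of_le a (le_iSup_of_le (b + 1) le_rfl)) _)
    rw [← ENNReal.ofReal_mul (by positivity)]
    refine ENNReal.ofReal_le_ofReal ?_
    -- Compare `ρ` with `g_{m-1}`, at distance at most `2`. The composition has `a + b + 1` maps, so
    -- one factor `exp(-βc)` is to spare.
    have hg : IsDensity (orbitSeq T g₀ (z - a - 1) x) := hg₀d _
    refine (hcontr x z a b ρ _ hρ hg).trans ?_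
    refine (mul_le_mul_of_nonneg_left (hρ.traceNorm_sub_le hg) (by positivity)).trans ?_
    rw [mul_comm _ (2 : ℝ), ← mul_assoc]
    refine mul_le_mul_of_nonneg_left (Real.exp_le_exp.mpr ?_) (by positivity)
    push_cast
    nlinarith [mul_pos hβ0 hc0]
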